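/- Let $H$ be a complex Hilbert space, with inner product antilinear in the first argument, and let $A\colon H\supseteq D(A)\to H$ be a closed linear operator. For a linear operator $T$ in $H$ write $\rho(T)$ for the set of $\lambda\in\mathbb C$ such that $\lambda-T\colon D(T)\to H$ is bijective with bounded inverse, $\sigma(T)=\mathbb C\setminus\rho(T)$, and $W(T)=\{\langle f,Tf\rangle : f\in D(T),\ \|f\|=1\}$. Suppose there is $\delta>0$ such that $$\sigma(A)\cup\overline{W(A)}\subseteq\{\lambda\in\mathbb C : \operatorname{Im}\lambda\ge\delta\}.$$ Then $(-\infty,0]\subseteq\rho(A)$, and $A$ has a square root, that is, there is a closed linear operator $B\colon H\supseteq D(B)\to H$ with $B^2=A$ (where $D(B^2)=\{x\in D(B): Bx\in D(B)\}$) and $\sigma(B)\subseteq\{\lambda : \operatorname{Re}\lambda\ge0\}$. Moreover, $B=:A^{1/2}$ can be chosen such that $\sigma(B)$ and $W(B)$ are contained in the closed first quadrant $\{\lambda : \operatorname{Re}\lambda\ge0,\ \operatorname{Im}\lambda\ge0\}$ and $\sigma(B)\subseteq\overline{W(B)}$; and it is the only square root of $A$ in this sense whose numerical range is contained in the closed first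 quadrant. -/

import Mathlib

namespace LinearPMap

variable {H : Type*} [NormedAddCommGroup H] [InnerProductSpace ℂ H]

/-- The resolvent set of a (possibly unbounded) operator `A`: all `z` for which `z - A`, defined on
the domain of `A`, has a two-sided inverse that is a bounded operator on the whole space. -/
def resolventSet (A : H →ₗ.[ℂ] H) : Set ℂ :=
  {z | ∃ R : H →L[ℂ] H,
    (∀ x : A.domain, R (z • (x : H) - A x) = x) ∧
    (∀ y : H, ∃ h : R y ∈ A.domain, z • R y - A ⟨R y, h⟩ = y)}

/-- The spectrum of an operator, the complement of its resolvent set. -/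
def spectrum (A : H →ₗ.[ℂ] H) : Set ℂ := A.resolventSetᶜ

/-- The numerical range. Mathlib's inner product is antilinear in the first argument. -/
def numericalRange (A : H →ₗ.[ℂ] H) : Set ℂ :=
  {w | ∃ f : A.domain, ‖(f : H)‖ = 1 ∧ inner ℂ (f : H) (A f) = w}

/-- The operator `B²`, with its natural domain `{x ∈ D(B) | B x ∈ D(B)}`. -/
def square (B : H →ₗ.[ℂ] H) : H →ₗ.[ℂ] H where
  domain :=
    { carrier := {x | ∃ hx : x ∈ B.domain, B ⟨x, hx⟩ ∈ B.domain}
      zero_mem' := ⟨B.domain.zero_mem, by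
        have h : B ⟨0, B.domain.zero_mem⟩ = 0 := B.map_zero
        rw [h]; exact B.domain.zero_mem⟩
      add_mem' := by
        rintro x y ⟨hx, hBx⟩ ⟨hy, hBy⟩
        refine ⟨B.domain.add_mem hx hy, ?_⟩
        have h : B ⟨x + y, B.domain.add_mem hx hy⟩ = B ⟨x, hx⟩ + B ⟨y, hy⟩ :=
          B.map_add ⟨x, hx⟩ ⟨y, hy⟩
        rw [h]; exact B.domain.add_mem hBx hBy
      smul_mem' := by
        rintro c x ⟨hx, hBx⟩
        refine ⟨B.domain.smul_mem c hx, ?_⟩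
        have h : B ⟨c • x, B.domain.smul_mem c hx⟩ = c • B ⟨x, hx⟩ := B.map_smul c ⟨x, hx⟩
        rw [h]; exact B.domain.smul_mem c hBx }
  toFun :=
    { toFun := fun x => B ⟨B ⟨x.1, x.2.1⟩, x.2.2⟩
      map_add' := by
        rintro ⟨x, hx, hBx⟩ ⟨y, hy, hBy⟩
        rw [← B.map_add]
        congr 1
        exact Subtype.ext (B.map_add ⟨x, hx⟩ ⟨y, hy⟩)
      map_smul' := by
        rintro c ⟨x, hx, hBx⟩
        rw [RingHom.id_apply, ← B.map_smul]
        congr 1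
        exact Subtype.ext (B.map_smul c ⟨x, hx⟩) }

/-- `B` is a square root of `A`: `A` is closed with `(-∞, 0] ⊆ ρ(A)`, and `B` is a closed operator
with `B² = A` (equality of domains included) and `σ(B)` in the closed right half plane. -/
structure IsSquareRoot (A B : H →ₗ.[ℂ] H) : Prop where
  isClosed_base : A.IsClosed
  nonpos_mem_resolventSet : ∀ t : ℝ, t ≤ 0 → (t : ℂ) ∈ A.resolventSet
  isClosed_root : B.IsClosed
  square_eq : B.square = A
  spectrum_subset : B.spectrum ⊆ {z | 0 ≤ z.re}

end LinearPMap

/-- The closed first quadrant of the complex plane. -/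
def firstQuadrant : Set ℂ := {z | 0 ≤ z.re ∧ 0 ≤ z.im}

/-! Everything is moved to the bounded inverse `K` of `A`. The bound on the numerical range reads
`δ‖Ky‖² ≤ Im ⟪Ky, y⟫`, which says exactly that `C = 1 - 2iδK` is a contraction. The binomial series
of `√(1 - c)`, with Catalan coefficients, converges absolutely for `‖c‖ ≤ 1`, so `2iδK = 1 - C` has
a square root, and a scalar multiple of it is a root `S` of `K`; the root of `A` is `B = S⁻¹`.

Quadrants: along `√(1 - tC)` the squares are strictly accretive for `t < 1`, and a continuity
argument (`re_mul_inner_nonneg_of_continuousOn`) keeps the form in the sector `|arg| ≤ π/4`. The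
scalar turns this into the fourth quadrant for `S`, and inversion conjugates it into the first for
`B`. Since `W(B)` is convex, a point off its closure lies in a half-plane missing `W(B)` and meeting
`ρ(B)`, hence lies in `ρ(B)`.

Uniqueness: another root has a bounded inverse `T` with `T² = K`, so `T` commutes with `K` and with
`S`. Then `(S + T)(S - T) = 0`, and `S + T` is injective because the quadrant is a pointed cone. -/

/-! ### Summability of the Catalan coefficients -/

open Finset in
-- The convolution recurrence gives `s (N + 1) ≤ 1 + (s N)² / 4` for the partial sums, and `2` is
-- the fixed point of this map.
theorem sum_catalan_div_four_pow_le (N : ℕ) :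
    ∑ n ∈ range N, (catalan n : ℝ) / 4 ^ n ≤ 2 := by
  induction N with
  | zero => simp
  | succ N ih =>
    have h0 : ∀ n, (0 : ℝ) ≤ (catalan n : ℝ) / 4 ^ n := fun n => by positivity
    have key : ∑ n ∈ range N, (catalan (n + 1) : ℝ) / 4 ^ (n + 1) ≤
        (1 / 4) * (∑ n ∈ range N, (catalan n : ℝ) / 4 ^ n) ^ 2 := by
      have h1 : ∀ n, (catalan (n + 1) : ℝ) / 4 ^ (n + 1) = (1 / 4) *
          ∑ p ∈ antidiagonal n, ((catalan p.1 : ℝ) / 4 ^ p.1) * ((catalan p.2 : ℝ) / 4 ^ p.2) := by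
        intro n
        rw [catalan_succ']
        push_cast
        rw [sum_div, mul_sum]
        refine sum_congr rfl fun p hp => ?_
        rw [← HasAntidiagonal.mem_antidiagonal.mp hp, pow_succ, pow_add]
        field_simp
      simp_rw [h1]
      rw [← mul_sum, sq, sum_mul_sum, ← sum_product']
      refine mul_le_mul_of_nonneg_left ?_ (by norm_num)
      rw [sum_sigma']
      have : ∑ x ∈ (range N).sigma fun n => antidiagonal n,
          ((catalan x.2.1 : ℝ) / 4 ^ x.2.1) * ((catalan x.2.2 : ℝ) / 4 ^ x.2.2) =
          ∑ p ∈ ((range N).sigma fun n => antidiagonal n).image (fun x => x.2),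
            ((catalan p.1 : ℝ) / 4 ^ p.1) * ((catalan p.2 : ℝ) / 4 ^ p.2) := by
        rw [sum_image]
        rintro ⟨a, p⟩ ha ⟨b, q⟩ hb h
        simp only [coe_sigma, Set.mem_sigma_iff, mem_coe, HasAntidiagonal.mem_antidiagonal] at ha hb h
        subst h
        have : a = b := ha.2.symm.trans hb.2
        subst this; rfl
      rw [this]
      refine sum_le_sum_of_subset_of_nonneg ?_ fun p _ _ => mul_nonneg (h0 _) (h0 _)
      intro p hp
      simp only [mem_image, mem_sigma, mem_range, HasAntidiagonal.mem_antidiagonal, Sigma.exists, mem_product] at hp ⊢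
      obtain ⟨a, q, ⟨h1, h2⟩, rfl⟩ := hp
      omega
    rw [sum_range_succ']
    have hs : 0 ≤ ∑ n ∈ range N, (catalan n : ℝ) / 4 ^ n := sum_nonneg fun n _ => h0 n
    simp only [catalan_zero, Nat.cast_one, pow_zero, div_one]
    nlinarith

theorem summable_catalan_div_four_pow : Summable fun n => (catalan n : ℝ) / 4 ^ n :=
  summable_of_sum_range_le (fun n => by positivity) sum_catalan_div_four_pow_le

/-! ### The square root of `1 - c` as a power series -/

section Root
variable {R : Type*} [NormedRing R] [NormedAlgebra ℝ R]

/-- The Catalan generating function at `c / 4`. -/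
noncomputable def catalanSeries (c : R) : R := ∑' n, ((catalan n : ℝ) / 4 ^ n) • c ^ n

theorem norm_catalan_smul_pow_le [NormOneClass R] {c : R} (hc : ‖c‖ ≤ 1) (n : ℕ) :
    ‖((catalan n : ℝ) / 4 ^ n) • c ^ n‖ ≤ (catalan n : ℝ) / 4 ^ n := by
  rw [norm_smul, Real.norm_of_nonneg (by positivity)]
  exact mul_le_of_le_one_right (by positivity) ((norm_pow_le c n).trans (pow_le_one₀ (norm_nonneg c) hc))

theorem summable_norm_catalan_smul_pow [NormOneClass R] {c : R} (hc : ‖c‖ ≤ 1) :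
    Summable fun n => ‖((catalan n : ℝ) / 4 ^ n) • c ^ n‖ :=
  Summable.of_nonneg_of_le (fun _ => norm_nonneg _) (norm_catalan_smul_pow_le hc)
    summable_catalan_div_four_pow

/-- The Catalan recurrence, read as a Cauchy product of absolutely convergent series. -/
theorem catalanSeries_eq [NormOneClass R] [CompleteSpace R] {c : R} (hc : ‖c‖ ≤ 1) :
    catalanSeries c = 1 + (1 / 4 : ℝ) • (c * (catalanSeries c * catalanSeries c)) := by
  have hs := summable_norm_catalan_smul_pow hc
  have h2 := (summable_norm_sum_mul_antidiagonal_of_summable_norm hs hs).of_norm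
  conv_lhs => rw [catalanSeries, hs.of_norm.tsum_eq_zero_add]
  rw [catalanSeries, tsum_mul_tsum_eq_tsum_sum_antidiagonal_of_summable_norm hs hs,
    ← h2.tsum_mul_left, ← (h2.mul_left c).tsum_const_smul]
  congr 1
  · simp
  · refine tsum_congr fun n => ?_
    rw [catalan_succ', Nat.cast_sum, Finset.sum_div, Finset.sum_smul, Finset.mul_sum, Finset.smul_sum]
    refine Finset.sum_congr rfl fun p hp => ?_
    rw [← Finset.HasAntidiagonal.mem_antidiagonal.mp hp, smul_mul_smul_comm, ← pow_add, mul_smul_comm, ← pow_succ',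
      smul_smul]
    congr 1
    push_cast
    rw [pow_succ, pow_add]
    field_simp

/-- The principal square root of `1 - c`, for a contraction `c`. -/
noncomputable def sqrtOneSub (c : R) : R := 1 - (1 / 2 : ℝ) • (c * catalanSeries c)

theorem Commute.catalanSeries_right [NormOneClass R] [CompleteSpace R] {a c : R} (hc : ‖c‖ ≤ 1)
    (h : Commute a c) : Commute a (catalanSeries c) := by
  have hs := (summable_norm_catalan_smul_pow hc).of_norm
  unfold Commute SemiconjBy catalanSeries
  rw [← hs.tsum_mul_left, ← hs.tsum_mul_right]
  exact tsum_congr fun n => ((h.pow_right n).smul_right _).eq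

theorem Commute.sqrtOneSub_right [NormOneClass R] [CompleteSpace R] {a c : R} (hc : ‖c‖ ≤ 1)
    (h : Commute a c) : Commute a (sqrtOneSub c) :=
  (Commute.one_right a).sub_right ((h.mul_right (h.catalanSeries_right hc)).smul_right _)

/-- With `w = c * g` the functional equation becomes `w = c + w² / 4`, so `(1 - w / 2)² = 1 - c`. -/
theorem sqrtOneSub_mul_self [NormOneClass R] [CompleteSpace R] {c : R} (hc : ‖c‖ ≤ 1) :
    sqrtOneSub c * sqrtOneSub c = 1 - c := by
  have hg := catalanSeries_eq hc
  have hcomm : Commute c (catalanSeries c) := (Commute.refl c).catalanSeries_right hc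
  set g := catalanSeries c
  have h1 : c * g * (c * g) = c * (c * (g * g)) := by
    rw [mul_assoc, ← mul_assoc g c g, ← hcomm.eq, mul_assoc]
  have h2 : c * g = c + (1 / 4 : ℝ) • (c * g * (c * g)) := by
    rw [h1]
    conv_lhs => rw [hg, mul_add, mul_one, mul_smul_comm]
  unfold sqrtOneSub
  change (1 - (1 / 2 : ℝ) • (c * g)) * (1 - (1 / 2 : ℝ) • (c * g)) = 1 - c
  rw [sub_mul, mul_sub, mul_one, one_mul, mul_sub, mul_one, smul_mul_smul_comm]
  set w := c * g
  have h3 : c = w - (1 / 4 : ℝ) • (w * w) := by rw [eq_sub_iff_add_eq]; exact h2.symm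
  rw [h3]
  module

theorem continuousOn_sqrtOneSub [NormOneClass R] [CompleteSpace R] :
    ContinuousOn (sqrtOneSub : R → R) {c | ‖c‖ ≤ 1} := by
  have : ContinuousOn (catalanSeries : R → R) {c | ‖c‖ ≤ 1} :=
    continuousOn_tsum (fun n => (by fun_prop)) summable_catalan_div_four_pow
      fun n c hc => norm_catalan_smul_pow_le hc n
  unfold sqrtOneSub
  fun_prop

end Root

open Complex Filter Topology InnerProductSpace

/-! ### Accretive operators and the continuity method -/

section Accretive
variable {H : Type*} [NormedAddCommGroup H] [InnerProductSpace ℂ H] [CompleteSpace H]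

omit [CompleteSpace H] in
/-- A quantitative Cauchy–Schwarz inequality for a symmetric nonnegative operator. -/
theorem norm_sq_apply_le_of_nonneg {P : H →L[ℂ] H} (hsymm : ∀ x y, inner ℂ (P x) y = inner ℂ x (P y))
    (hP : ∀ x, 0 ≤ (inner ℂ x (P x)).re) (x : H) :
    ‖P x‖ ^ 2 ≤ (‖P‖ + 1) * (inner ℂ x (P x)).re := by
  -- Nonnegativity is tested at `x - t P x`; the `+ 1` covers `P = 0`.
  set t : ℝ := (‖P‖ + 1)⁻¹ with ht
  have hM : 0 < ‖P‖ + 1 := by positivity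
  have ht0 : 0 < t := by positivity
  have h1 := hP (x - (t : ℂ) • P x)
  have e1 : (inner ℂ (x - (t : ℂ) • P x) (P (x - (t : ℂ) • P x))).re =
      (inner ℂ x (P x)).re - 2 * t * ‖P x‖ ^ 2 + t ^ 2 * (inner ℂ (P x) (P (P x))).re := by
    simp only [map_sub, map_smul, inner_sub_left, inner_sub_right, inner_smul_left,
      inner_smul_right, ← hsymm x (P x), inner_self_eq_norm_sq_to_K]
    simp [← ofReal_pow]
    ring
  have e2 : (inner ℂ (P x) (P (P x))).re ≤ ‖P‖ * ‖P x‖ ^ 2 := by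
    calc (inner ℂ (P x) (P (P x))).re ≤ ‖P x‖ * ‖P (P x)‖ := re_inner_le_norm (𝕜 := ℂ) _ _
      _ ≤ ‖P x‖ * (‖P‖ * ‖P x‖) := by gcongr; exact P.le_opNorm _
      _ = _ := by ring
  have e3 : t * (‖P‖ + 1) = 1 := inv_mul_cancel₀ hM.ne'
  have e4 : t ^ 2 * (inner ℂ (P x) (P (P x))).re ≤ t * ‖P x‖ ^ 2 := by
    calc _ ≤ t ^ 2 * ((‖P‖ + 1) * ‖P x‖ ^ 2) := by
          gcongr; nlinarith [sq_nonneg ‖P x‖]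
      _ = (t * (‖P‖ + 1)) * (t * ‖P x‖ ^ 2) := by ring
      _ = _ := by rw [e3, one_mul]
  have e5 : t * ‖P x‖ ^ 2 ≤ (inner ℂ x (P x)).re := by nlinarith
  calc ‖P x‖ ^ 2 = (‖P‖ + 1) * (t * ‖P x‖ ^ 2) := by rw [← mul_assoc, mul_comm _ t, e3, one_mul]
    _ ≤ _ := by gcongr

open ContinuousLinearMap in
theorem inner_add_adjoint_apply_symm (S : H →L[ℂ] H) (x y : H) :
    inner ℂ ((S + adjoint S) x) y = inner ℂ x ((S + adjoint S) y) := by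
  simp [adjoint_inner_left, adjoint_inner_right, add_comm]

open ContinuousLinearMap in
theorem inner_add_adjoint_apply_self (S : H →L[ℂ] H) (x : H) :
    (inner ℂ x ((S + adjoint S) x)).re = 2 * (inner ℂ x (S x)).re := by
  have : (inner ℂ (S x) x).re = (inner ℂ x (S x)).re := by
    rw [← inner_conj_symm, conj_re]
  simp [adjoint_inner_right, this, two_mul]

open ContinuousLinearMap in
/-- An accretive operator whose quadratic form has vanishing real part at `x` is skew at `x`. -/
theorem apply_add_adjoint_eq_zero {S : H →L[ℂ] H} (hS : ∀ x, 0 ≤ (inner ℂ x (S x)).re) {x : H}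
    (hx : (inner ℂ x (S x)).re = 0) : S x + adjoint S x = 0 := by
  have h := norm_sq_apply_le_of_nonneg (inner_add_adjoint_apply_symm S)
    (fun x => by rw [inner_add_adjoint_apply_self]; have := hS x; positivity) x
  rw [inner_add_adjoint_apply_self, hx, mul_zero, mul_zero] at h
  have h0 : ‖(S + adjoint S) x‖ ^ 2 = 0 := le_antisymm h (sq_nonneg _)
  simpa using h0

open ContinuousLinearMap in
theorem adjoint_smul_apply' (c : ℂ) (S : H →L[ℂ] H) (x : H) :
    adjoint (c • S) x = (starRingEnd ℂ c) • adjoint S x := by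
  simp [map_smulₛₗ]

/-- If the values of the form of `S` lie in the closed fourth quadrant, then `S` vanishes where
its form does. -/
theorem apply_eq_zero_of_inner_eq_zero {S : H →L[ℂ] H} (hre : ∀ x, 0 ≤ (inner ℂ x (S x)).re)
    (him : ∀ x, (inner ℂ x (S x)).im ≤ 0) {x : H} (hx : inner ℂ x (S x) = 0) : S x = 0 := by
  -- Applied to `S` and to `iS`, the skewness gives `S x = -S* x` and `S x = S* x`.
  have h1 := apply_add_adjoint_eq_zero hre (x := x) (by simp [hx])
  have h2 := apply_add_adjoint_eq_zero (S := I • S) (x := x)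
    (fun x => by simpa [inner_smul_right] using him x) (by simp [hx])
  rw [adjoint_smul_apply', _root_.smul_apply, conj_I, neg_smul, ← sub_eq_add_neg,
    ← smul_sub, smul_eq_zero_iff_right I_ne_zero] at h2
  rw [sub_eq_zero] at h2
  rw [← h2, ← two_smul ℂ] at h1
  simpa using h1

open ContinuousLinearMap in
/-- If `X ^ 2` is strictly accretive and `e • X` is accretive for some `e` with `e ^ 2` purely
imaginary, then `e • X` is strictly accretive. -/
theorem exists_pos_le_re_inner {X : H →L[ℂ] H} {e : ℂ} (he : (e ^ 2).re = 0) (he0 : e ≠ 0) {g : ℝ}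
    (hg : 0 < g) (hX : ∀ x, g * ‖x‖ ^ 2 ≤ (inner ℂ x (X (X x))).re)
    (hpos : ∀ x, 0 ≤ (e * inner ℂ x (X x)).re) :
    ∃ c > 0, ∀ x, c * ‖x‖ ^ 2 ≤ (e * inner ℂ x (X x)).re := by
  set P : H →L[ℂ] H := e • X + adjoint (e • X) with hP
  set Q : H →L[ℂ] H := starRingEnd ℂ e • X + adjoint (starRingEnd ℂ e • X) with hQ
  have hform : ∀ x, (inner ℂ x (P x)).re = 2 * (e * inner ℂ x (X x)).re := fun x => by
    rw [hP, inner_add_adjoint_apply_self, _root_.smul_apply, inner_smul_right]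
  -- The terms in `‖X x‖²` and `‖X* x‖²` carry the factor `Re e² = 0`; only the cross terms survive.
  -- Cauchy–Schwarz then bounds `‖P x‖` from below.
  have hPQ : ∀ x, (inner ℂ (P x) (Q x)).re = 2 * normSq e * (inner ℂ x (X (X x))).re := by
    intro x
    have h1 : inner ℂ (adjoint X x) (X x) = inner ℂ x (X (X x)) := adjoint_inner_left ..
    have h2 : inner ℂ (X x) (adjoint X x) = starRingEnd ℂ (inner ℂ x (X (X x))) := by
      rw [← h1, inner_conj_symm]
    simp only [hP, hQ, _root_.add_apply, _root_.smul_apply,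
      adjoint_smul_apply', inner_add_left, inner_add_right, inner_smul_left, inner_smul_right, h1,
      h2, inner_self_eq_norm_sq_to_K, conj_conj]
    rw [sq, mul_re] at he
    simp [normSq_apply, ← ofReal_pow]
    have h3 : (inner ℂ (X (X x)) x).re = (inner ℂ x (X (X x))).re := by
      rw [← inner_conj_symm, conj_re]
    linear_combination (‖X x‖ ^ 2 + ‖adjoint X x‖ ^ 2) * he + (e.re ^ 2 + e.im ^ 2) * h3
  have he1 : 0 < normSq e := normSq_pos.2 he0
  set M : ℝ := ‖Q‖ + 1
  have hM : 0 < M := by positivity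
  set m : ℝ := 2 * normSq e * g / M
  have hm : 0 < m := by positivity
  have hlow : ∀ x, m * ‖x‖ ≤ ‖P x‖ := by
    intro x
    rcases (norm_nonneg x).eq_or_lt with h | h
    · rw [← h]; simp
    rw [div_mul_eq_mul_div, div_le_iff₀ hM]
    have h3 : 2 * normSq e * (g * ‖x‖ ^ 2) ≤ ‖P x‖ * (M * ‖x‖) := by
      calc _ ≤ 2 * normSq e * (inner ℂ x (X (X x))).re := by gcongr; exact hX x
        _ = _ := (hPQ x).symm
        _ ≤ ‖P x‖ * ‖Q x‖ := re_inner_le_norm (𝕜 := ℂ) _ _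
        _ ≤ _ := by
          gcongr
          exact (Q.le_opNorm x).trans (by gcongr; simp [M])
    refine le_of_mul_le_mul_right ?_ h
    linarith
  refine ⟨m ^ 2 / (2 * (‖P‖ + 1)), by positivity, fun x => ?_⟩
  have h4 := norm_sq_apply_le_of_nonneg (inner_add_adjoint_apply_symm (e • X))
    (fun x => by have := hpos x; rw [← hP, hform]; positivity) x
  rw [← hP, hform] at h4
  have h5 : m ^ 2 * ‖x‖ ^ 2 ≤ ‖P x‖ ^ 2 := by
    rw [← mul_pow]; exact pow_le_pow_left₀ (by positivity) (hlow x) 2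
  rw [div_mul_eq_mul_div, div_le_iff₀ (by positivity)]
  linarith

/-- The good `t` form a closed set containing `0`. At a good `t < 1` the form is strictly positive
by `exists_pos_le_re_inner`, so norm continuity extends it to the right. Strictness may fail at `1`,
which is reached by closedness. -/
theorem re_mul_inner_nonneg_of_continuousOn {X : ℝ → H →L[ℂ] H} (hX : ContinuousOn X (Set.Icc 0 1))
    (hX0 : X 0 = 1) (hacc : ∀ t ∈ Set.Ico (0 : ℝ) 1, ∃ g > 0, ∀ x,
      g * ‖x‖ ^ 2 ≤ (inner ℂ x (X t (X t x))).re)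
    {e : ℂ} (he : (e ^ 2).re = 0) (he0 : 0 < e.re) (x : H) :
    0 ≤ (e * inner ℂ x (X 1 x)).re := by
  set s : Set ℝ := {t | ∀ x, 0 ≤ (e * inner ℂ x (X t x)).re} with hs
  have hclosed : IsClosed (s ∩ Set.Icc 0 1) := by
    have : s ∩ Set.Icc 0 1 = Set.Icc 0 1 ∩ ⋂ x, {t | t ∈ Set.Icc (0 : ℝ) 1 ∧ 0 ≤ (e * inner ℂ x (X t x)).re} := by
      ext t
      simp only [hs, Set.mem_inter_iff, Set.mem_ofPred_eq, Set.mem_iInter]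
      exact ⟨fun h => ⟨h.2, fun x => ⟨h.2, h.1 x⟩⟩, fun h => ⟨fun x => (h.2 x).2, h.1⟩⟩
    rw [this]
    refine isClosed_Icc.inter (isClosed_iInter fun x => ?_)
    refine ContinuousOn.preimage_isClosed_of_isClosed (f := fun t => (e * inner ℂ x (X t x)).re)
      (t := Set.Ici 0) ?_ isClosed_Icc isClosed_Ici
    have h1 : ContinuousOn (fun t => X t x) (Set.Icc 0 1) := hX.clm_apply continuousOn_const
    exact continuous_re.comp_continuousOn (continuousOn_const.mul ((innerSL ℂ x).continuous.comp_continuousOn h1))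
  have hzero : (0 : ℝ) ∈ s := fun x => by
    rw [hX0, one_apply_eq_self, inner_self_eq_norm_sq_to_K]
    simp only [coe_algebraMap, ← ofReal_pow, re_mul_ofReal]
    positivity
  refine hclosed.Icc_subset_of_forall_mem_nhdsWithin hzero (fun t ht => ?_)
    (Set.right_mem_Icc.2 zero_le_one) x
  obtain ⟨g, hg, hgX⟩ := hacc t ht.2
  have hene : e ≠ 0 := fun h => by simp [h] at he0
  obtain ⟨c, hc, hcX⟩ := exists_pos_le_re_inner he hene hg hgX ht.1
  have hcont : Tendsto X (𝓝[>] t) (𝓝 (X t)) := by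
    refine (hX t (Set.Ico_subset_Icc_self ht.2)).mono_left ?_
    rw [← nhdsWithin_Ioc_eq_nhdsGT ht.2.2]
    exact nhdsWithin_mono _ fun r hr => ⟨ht.2.1.trans hr.1.le, hr.2⟩
  have hr : 0 < c / ‖e‖ := div_pos hc (norm_pos_iff.2 hene)
  filter_upwards [hcont (Metric.ball_mem_nhds _ hr)] with r hrX x
  rw [Set.mem_preimage, mem_ball_iff_norm] at hrX
  have h1 : (e * inner ℂ x (X r x)).re = (e * inner ℂ x (X t x)).re +
      (e * inner ℂ x ((X r - X t) x)).re := by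
    rw [_root_.sub_apply, inner_sub_right, ← add_re]; congr 1; ring
  have h2 : |(e * inner ℂ x ((X r - X t) x)).re| ≤ c * ‖x‖ ^ 2 := by
    refine (abs_re_le_norm _).trans ?_
    rw [norm_mul]
    calc ‖e‖ * ‖inner ℂ x ((X r - X t) x)‖ ≤ ‖e‖ * (‖x‖ * (‖X r - X t‖ * ‖x‖)) := by
          gcongr
          exact (norm_inner_le_norm _ _).trans (by gcongr; exact (X r - X t).le_opNorm x)
      _ ≤ ‖e‖ * (‖x‖ * (c / ‖e‖ * ‖x‖)) := by gcongr
      _ = _ := by field_simp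
  have := hcX x
  have := (abs_le.1 h2).1
  linarith

end Accretive

namespace LinearPMap
variable {H : Type*} [NormedAddCommGroup H] [InnerProductSpace ℂ H]

/-! ### Convexity of the numerical range -/

section NumericalRange

theorem mem_numericalRange_of_inner_eq {B : H →ₗ.[ℂ] H} {w : ℂ} {x : B.domain} (hx : x ≠ 0)
    (h : inner ℂ (x : H) (B x) = w * (‖x‖ ^ 2 : ℝ)) : w ∈ B.numericalRange := by
  have hn : ‖(x : H)‖ ≠ 0 := norm_ne_zero_iff.2 (by simpa using hx)
  refine ⟨((‖x‖⁻¹ : ℝ) : ℂ) • x, ?_, ?_⟩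
  · rw [Submodule.coe_smul, norm_smul, norm_real, norm_inv, norm_norm]
    exact inv_mul_cancel₀ hn
  · rw [B.map_smul, Submodule.coe_smul, inner_smul_left, inner_smul_right, h, conj_ofReal]
    have : ((‖x‖ : ℝ) : ℂ) ≠ 0 := ofReal_ne_zero.2 hn
    push_cast
    field_simp

/-- **Toeplitz–Hausdorff theorem**: the numerical range is convex. -/
theorem convex_numericalRange (B : H →ₗ.[ℂ] H) : Convex ℝ B.numericalRange := by
  rintro a ⟨f, hf, rfl⟩ b ⟨g, hg, hb⟩ r s hr hs hrs
  set a := inner ℂ (f : H) (B f) with ha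
  by_cases hab : a = b
  · rw [← hab, ← add_smul, hrs, one_smul]; exact ⟨f, hf, rfl⟩
  have hba : b - a ≠ 0 := sub_ne_zero.2 (Ne.symm hab)
  -- The affine change of variable sending `a` to `0` and `b` to `1`.
  set q : B.domain → B.domain → ℂ := fun x y =>
    (inner ℂ (x : H) (B y) - a * inner ℂ (x : H) (y : H)) / (b - a) with hq
  have hqf : q f f = 0 := by
    simp [hq, ← ha, inner_self_eq_norm_sq_to_K, hf]
  have hqg : q g g = 1 := by
    simp only [hq, hb, inner_self_eq_norm_sq_to_K, hg]
    field_simp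
    simp
  -- A phase on `f` that makes the cross terms real, so `q` is real along the path from `ω • f` to
  -- `g`.
  obtain ⟨ω, hω, him⟩ : ∃ ω : ℂ, ‖ω‖ = 1 ∧
      (starRingEnd ℂ ω * q f g + ω * q g f).im = 0 := by
    set z := starRingEnd ℂ (q g f - starRingEnd ℂ (q f g)) with hz
    have key : ∀ ω : ℂ, (starRingEnd ℂ ω * q f g + ω * q g f).im = (ω * starRingEnd ℂ z).im := by
      intro ω; simp [hz]; ring
    by_cases h0 : z = 0
    · exact ⟨1, by simp, by rw [key, h0]; simp⟩
    · refine ⟨z / ‖z‖, by simp [h0], ?_⟩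
      rw [key, div_mul_eq_mul_div, mul_conj, ← ofReal_div, ofReal_im]
  set x : ℝ → B.domain := fun t => (((1 - t : ℝ) : ℂ) * ω) • f + (t : ℂ) • g with hx
  have hqx : ∀ t, q (x t) (x t) = ((t ^ 2 + (1 - t) * t *
      (starRingEnd ℂ ω * q f g + ω * q g f).re : ℝ) : ℂ) := by
    intro t
    have h1 : q (x t) (x t) = ((1 - t : ℝ) : ℂ) ^ 2 * (starRingEnd ℂ ω * ω) * q f f +
        ((1 - t : ℝ) : ℂ) * t * (starRingEnd ℂ ω * q f g + ω * q g f) + (t : ℂ) ^ 2 * q g g := by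
      simp only [hq, hx, B.map_add, B.map_smul, Submodule.coe_add, Submodule.coe_smul,
        inner_add_left, inner_add_right, inner_smul_left, inner_smul_right, map_mul, conj_ofReal]
      field_simp
      ring
    rw [h1, hqf, hqg]
    have h2 : starRingEnd ℂ ω * q f g + ω * q g f =
      ((starRingEnd ℂ ω * q f g + ω * q g f).re : ℂ) := Complex.ext (by simp) (by simpa using him)
    rw [h2]
    push_cast
    simp only [ofReal_re]
    ring
  -- A zero would make `g` a multiple of `f`, forcing `q g g = 0`.
  have hxne : ∀ t, x t ≠ 0 := by
    intro t h
    have h1 : (((1 - t : ℝ) : ℂ) * ω) • f = -((t : ℂ) • g) := eq_neg_of_add_eq_zero_left h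
    have hn := congrArg norm h1
    rw [norm_neg, norm_smul, norm_smul, norm_mul, hω, mul_one, Submodule.norm_coe f |>.symm, hf,
      Submodule.norm_coe g |>.symm, hg, mul_one, mul_one, norm_real, norm_real, Real.norm_eq_abs,
      Real.norm_eq_abs] at hn
    have hq0 := hqx t
    have hq1 : q (x t) (x t) = 0 := by rw [h]; simp [hq]
    have ht : t = 1 / 2 := by
      rcases abs_eq_abs.1 hn with h' | h' <;> linarith
    have hfg : ω • f = -g := by
      have : ((1 / 2 : ℝ) : ℂ) ≠ 0 := by norm_num
      rw [ht] at h1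
      norm_num [mul_smul] at h1
      rw [← smul_neg] at h1
      exact smul_right_injective _ (by norm_num : (1 / 2 : ℂ) ≠ 0) h1
    have h3 : g = (-ω) • f := by rw [neg_smul, hfg, neg_neg]
    have h4 : q g g = 0 := by
      rw [h3]
      have : q ((-ω) • f) ((-ω) • f) = starRingEnd ℂ (-ω) * (-ω) * q f f := by
        simp only [hq, B.map_smul, Submodule.coe_smul, inner_smul_left, inner_smul_right]
        rw [div_eq_mul_inv, div_eq_mul_inv]; ring
      rw [this, hqf, mul_zero]
    rw [hqg] at h4
    exact one_ne_zero h4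
  set F : ℝ → ℝ := fun t => t ^ 2 + (1 - t) * t *
      (starRingEnd ℂ ω * q f g + ω * q g f).re - s * ‖x t‖ ^ 2 with hF
  have hFc : Continuous F := by
    have : Continuous x := by
      simp only [hx]; fun_prop
    simp only [hF]
    fun_prop
  have hF0 : F 0 ≤ 0 := by
    have : ‖x 0‖ = 1 := by simp [hx, norm_smul, hω, hf]
    simp only [hF, this]; simp [hs]
  have hF1 : 0 ≤ F 1 := by
    have : ‖x 1‖ = 1 := by simp [hx, hg]
    simp only [hF, this]; norm_num; linarith
  obtain ⟨t, -, ht⟩ := intermediate_value_Icc zero_le_one hFc.continuousOn ⟨hF0, hF1⟩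
  refine mem_numericalRange_of_inner_eq (hxne t) ?_
  have h5 : q (x t) (x t) = s * (‖x t‖ ^ 2 : ℝ) := by
    rw [hqx, ← ofReal_mul, ofReal_inj]; simp only [hF] at ht; linarith
  simp only [hq] at h5
  rw [div_eq_iff hba, inner_self_eq_norm_sq_to_K] at h5
  have h6 : r = 1 - s := by linarith
  rw [h6]
  simp only [real_smul]
  push_cast at h5 ⊢
  simp at h5 ⊢
  linear_combination h5

end NumericalRange

/-! ### Resolvent estimates and the spectrum -/

section Resolvent

/-- Neumann series: `w - B = (1 + (w - z) R)(z - B)`. -/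
theorem mem_resolventSet_of_norm_lt [CompleteSpace H] {B : H →ₗ.[ℂ] H} {z w : ℂ} {R : H →L[ℂ] H}
    (h1 : ∀ x : B.domain, R (z • (x : H) - B x) = x)
    (h2 : ∀ y : H, ∃ h : R y ∈ B.domain, z • R y - B ⟨R y, h⟩ = y)
    (hzw : ‖w - z‖ * ‖R‖ < 1) : w ∈ B.resolventSet := by
  set V := Units.oneSub (-((w - z) • R)) (by rwa [norm_neg, norm_smul]) with hV
  have hVv : (V : H →L[ℂ] H) = 1 + (w - z) • R := by simp [hV, Units.oneSub]
  have hVi : ∀ y, (V : H →L[ℂ] H) ((↑V⁻¹ : H →L[ℂ] H) y) = y := fun y => by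
    rw [← mul_apply_eq_comp, V.mul_inv]; rfl
  have hiV : ∀ y, (↑V⁻¹ : H →L[ℂ] H) ((V : H →L[ℂ] H) y) = y := fun y => by
    rw [← mul_apply_eq_comp, V.inv_mul]; rfl
  refine ⟨R * (↑V⁻¹ : H →L[ℂ] H), fun x => ?_, fun y => ?_⟩
  · have : w • (x : H) - B x = (V : H →L[ℂ] H) (z • (x : H) - B x) := by
      rw [hVv]
      simp only [_root_.add_apply, one_apply_eq_self,
        _root_.smul_apply, h1]
      module
    rw [mul_apply_eq_comp, this, hiV, h1]
  · obtain ⟨h, hy⟩ := h2 ((↑V⁻¹ : H →L[ℂ] H) y)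
    refine ⟨h, ?_⟩
    have h3 := hVi y
    rw [hVv] at h3
    simp only [_root_.add_apply, one_apply_eq_self,
        _root_.smul_apply] at h3
    conv_rhs => rw [← h3]
    conv_rhs => enter [1]; rw [← hy]
    simp only [mul_apply_eq_comp]
    module

theorem isOpen_resolventSet [CompleteSpace H] (B : H →ₗ.[ℂ] H) : IsOpen B.resolventSet := by
  rw [isOpen_iff_mem_nhds]
  rintro z ⟨R, h1, h2⟩
  have : ∀ᶠ w in 𝓝 z, ‖w - z‖ * ‖R‖ < 1 :=
    (by fun_prop : Continuous fun w : ℂ => ‖w - z‖ * ‖R‖).continuousAt.eventually_lt_const (by simp)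
  filter_upwards [this] with w hw using mem_resolventSet_of_norm_lt h1 h2 hw

/-- For `x = R y ≠ 0` one has `⟪x, y⟫ = ‖x‖² (z - v)` with `v` in the numerical range; apply `f` to
both sides. The real functional `f` allows half-planes in every direction. -/
theorem norm_resolvent_mul_le {B : H →ₗ.[ℂ] H} {f : StrongDual ℝ ℂ} {u : ℝ}
    (hf : ∀ b ∈ B.numericalRange, u ≤ f b) {z : ℂ} (hz : f z < u) {R : H →L[ℂ] H}
    (h2 : ∀ y : H, ∃ h : R y ∈ B.domain, z • R y - B ⟨R y, h⟩ = y) :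
    ‖R‖ * (u - f z) ≤ ‖f‖ := by
  have hd : 0 < u - f z := sub_pos.2 hz
  rw [← le_div_iff₀ hd]
  refine R.opNorm_le_bound (by positivity) fun y => ?_
  obtain ⟨h, hy⟩ := h2 y
  rcases (norm_nonneg (R y)).eq_or_lt with h0 | h0
  · rw [← h0]; positivity
  have hW : inner ℂ (R y) (B ⟨R y, h⟩) / (‖R y‖ ^ 2 : ℝ) ∈ B.numericalRange := by
    refine mem_numericalRange_of_inner_eq (x := ⟨R y, h⟩) (fun h' => ?_) ?_
    · rw [Submodule.mk_eq_zero] at h'; simp [h'] at h0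
    · exact (div_mul_cancel₀ _ (ofReal_ne_zero.2 (pow_pos h0 2).ne')).symm
  have h3 := hf _ hW
  set v := inner ℂ (R y) (B ⟨R y, h⟩) / (‖R y‖ ^ 2 : ℝ) with hv
  have h4 : inner ℂ (R y) y = ((‖R y‖ ^ 2 : ℝ) : ℂ) * (z - v) := by
    conv_lhs => enter [3]; rw [← hy]
    have : ((‖R y‖ ^ 2 : ℝ) : ℂ) ≠ 0 := ofReal_ne_zero.2 (pow_pos h0 2).ne'
    rw [inner_sub_right, inner_smul_right, inner_self_eq_norm_sq_to_K, mul_sub, hv,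
      mul_div_cancel₀ _ this]
    simp [mul_comm]
  have h5 : ‖R y‖ ^ 2 * (u - f z) ≤ ‖f‖ * (‖R y‖ * ‖y‖) := by
    have h6 : f (inner ℂ (R y) y) = ‖R y‖ ^ 2 * (f z - f v) := by
      rw [h4, ← real_smul, _root_.map_smul, smul_eq_mul, _root_.map_sub]
    have h7 := f.le_opNorm (inner ℂ (R y) y)
    rw [h6, Real.norm_eq_abs] at h7
    calc _ ≤ -(‖R y‖ ^ 2 * (f z - f v)) := by nlinarith [sq_nonneg ‖R y‖]
      _ ≤ _ := neg_le_abs _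
      _ ≤ _ := h7
      _ ≤ _ := by gcongr; exact norm_inner_le_norm _ _
  rw [div_mul_eq_mul_div, le_div_iff₀ hd]
  refine le_of_mul_le_mul_left ?_ h0
  linarith

/-- A half-plane disjoint from the numerical range that meets the resolvent set lies in it. -/
theorem halfPlane_subset_resolventSet [CompleteSpace H] {B : H →ₗ.[ℂ] H} {f : StrongDual ℝ ℂ}
    {u : ℝ} (hf : ∀ b ∈ B.numericalRange, u ≤ f b) {z : ℂ} (hz : f z < u)
    (hzB : z ∈ B.resolventSet) : {w | f w < u} ⊆ B.resolventSet := by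
  refine IsPreconnected.subset_of_closure_inter_subset
    (convex_halfSpace_lt f.toLinearMap.isLinear u).isPreconnected B.isOpen_resolventSet
    ⟨z, hz, hzB⟩ ?_
  rintro w ⟨hw, hwu⟩
  have hopen : IsOpen {z : ℂ | ‖w - z‖ * ‖f‖ < u - f z} :=
    isOpen_lt (by fun_prop) (by fun_prop)
  obtain ⟨z', hz', R, h1, h2⟩ := mem_closure_iff.1 hw _ hopen
    (by simpa using hwu)
  rw [Set.mem_ofPred_eq] at hz'
  have hd : 0 < u - f z' := lt_of_le_of_lt (by positivity) hz'
  have h3 := norm_resolvent_mul_le hf (sub_pos.1 hd) h2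
  refine mem_resolventSet_of_norm_lt h1 h2 ?_
  refine lt_of_mul_lt_mul_right ?_ hd.le
  calc ‖w - z'‖ * ‖R‖ * (u - f z') = ‖w - z'‖ * (‖R‖ * (u - f z')) := by ring
    _ ≤ ‖w - z'‖ * ‖f‖ := by gcongr
    _ < 1 * (u - f z') := by rwa [one_mul]

/-- If the numerical range lies in the first quadrant and `0` is a resolvent point, then the
spectrum lies in the closure of the numerical range. -/
theorem spectrum_subset_closure_numericalRange [CompleteSpace H] {B : H →ₗ.[ℂ] H}
    (hW : B.numericalRange ⊆ firstQuadrant) (h0 : 0 ∈ B.resolventSet) :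
    B.spectrum ⊆ _root_.closure B.numericalRange := by
  intro z hz
  by_contra hzW
  refine hz ?_
  obtain ⟨ε, hε, hball⟩ := Metric.isOpen_iff.1 B.isOpen_resolventSet 0 h0
  -- A resolvent point near `0` lying in both the open left and the open lower half-plane.
  set q : ℂ := ((ε / 4 : ℝ) : ℂ) * (-1 - I) with hq
  have hqB : q ∈ B.resolventSet := by
    apply hball
    rw [mem_ball_zero_iff, hq, norm_mul, norm_real, Real.norm_of_nonneg (by positivity)]
    have : ‖(-1 - I : ℂ)‖ ≤ 1 + 1 := (norm_sub_le _ _).trans (by simp)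
    nlinarith
  have hre : {w : ℂ | w.re < 0} ⊆ B.resolventSet :=
    halfPlane_subset_resolventSet (f := reCLM) (fun b hb => (hW hb).1) (z := q)
      (by simp [hq, hε]) hqB
  have him : {w : ℂ | w.im < 0} ⊆ B.resolventSet :=
    halfPlane_subset_resolventSet (f := imCLM) (fun b hb => (hW hb).2) (z := q)
      (by simp [hq, hε]) hqB
  obtain ⟨f, u, hfz, hfW⟩ := geometric_hahn_banach_point_closed
    B.convex_numericalRange.closure isClosed_closure hzW
  have hcoord : ∀ x y : ℝ, f (x + y * I) = x * f 1 + y * f I := by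
    intro x y
    have : (x + y * I : ℂ) = x • (1 : ℂ) + y • I := by simp
    rw [this, _root_.map_add, _root_.map_smul, _root_.map_smul, smul_eq_mul, smul_eq_mul]
  -- If `f I ≠ 0`, move along `Re = -1`; otherwise, if `f 1 ≠ 0`, along `Im = -1`. The case `f = 0`
  -- arises only for an empty numerical range.
  obtain ⟨p, hp, hpB⟩ : ∃ p, f p < u ∧ p ∈ B.resolventSet := by
    by_cases hI : f I = 0
    · by_cases h1 : f 1 = 0
      · refine ⟨-1, ?_, hre (by simp)⟩
        have hz0 := hcoord z.re z.im
        rw [re_add_im, h1, hI] at hz0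
        rw [_root_.map_neg, h1]
        linarith
      · refine ⟨((u - 1) / f 1 : ℝ) + (-1 : ℝ) * I, ?_, him (by simp)⟩
        rw [hcoord, hI, div_mul_cancel₀ _ h1]
        linarith
    · refine ⟨(-1 : ℝ) + ((u - 1 + f 1) / f I : ℝ) * I, ?_, hre (by simp)⟩
      rw [hcoord, div_mul_cancel₀ _ hI]
      linarith
  exact halfPlane_subset_resolventSet (fun b hb => (hfW b (subset_closure hb)).le) hp hpB hfz

end Resolvent
end LinearPMap

/-! ### The bounded square root and its uniqueness -/

section
variable {H : Type*} [NormedAddCommGroup H] [InnerProductSpace ℂ H] [CompleteSpace H]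

/-- A bounded operator `K` with `δ ‖K y‖² ≤ Im ⟪K y, y⟫` has a square root whose form takes values
in the closed fourth quadrant and which commutes with everything that commutes with `K`. -/
theorem exists_mul_self_eq_fourthQuadrant {K : H →L[ℂ] H} {δ : ℝ} (hδ : 0 < δ)
    (hK : ∀ y, δ * ‖K y‖ ^ 2 ≤ (inner ℂ (K y) y).im) :
    ∃ S : H →L[ℂ] H, S * S = K ∧ (∀ x, 0 ≤ (inner ℂ x (S x)).re) ∧
      (∀ x, (inner ℂ x (S x)).im ≤ 0) ∧ ∀ T : H →L[ℂ] H, Commute T K → Commute T S := by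
  rcases subsingleton_or_nontrivial H with hH | hH
  · exact ⟨0, Subsingleton.elim _ _, by simp, by simp, fun T _ => Commute.zero_right T⟩
  set C : H →L[ℂ] H := 1 - ((2 * δ : ℝ) * I : ℂ) • K with hCdef
  have hC : ‖C‖ ≤ 1 := by
    refine C.opNorm_le_bound zero_le_one fun y => ?_
    rw [one_mul]
    refine le_of_sq_le_sq ?_ (norm_nonneg y)
    have h1 : ‖C y‖ ^ 2 = ‖y‖ ^ 2 - 4 * δ * (inner ℂ (K y) y).im + 4 * δ ^ 2 * ‖K y‖ ^ 2 := by
      have h2 : (inner ℂ y (((2 * δ : ℝ) * I : ℂ) • K y)).re = 2 * δ * (inner ℂ (K y) y).im := by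
        rw [inner_smul_right, ← inner_conj_symm y (K y), mul_assoc, re_ofReal_mul, I_mul_re, conj_im,
          neg_neg]
      have h3 := @norm_sub_sq ℂ _ _ _ _ y (((2 * δ : ℝ) * I : ℂ) • K y)
      rw [RCLike.re_eq_complex_re, h2, norm_smul, norm_mul, norm_I, norm_real,
        Real.norm_of_nonneg (by positivity)] at h3
      rw [hCdef, _root_.sub_apply, one_apply_eq_self, _root_.smul_apply, h3]
      ring
    rw [h1]
    nlinarith [mul_le_mul_of_nonneg_left (hK y) hδ.le]
  have hCt : ∀ t ∈ Set.Icc (0 : ℝ) 1, ‖t • C‖ ≤ 1 := fun t ht => by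
    rw [norm_smul, Real.norm_of_nonneg ht.1]
    exact mul_le_one₀ ht.2 (norm_nonneg _) hC
  have hquad : ∀ e : ℂ, (e ^ 2).re = 0 → 0 < e.re → ∀ x,
      0 ≤ (e * inner ℂ x (sqrtOneSub C x)).re := by
    intro e he he0 x
    have h := re_mul_inner_nonneg_of_continuousOn (X := fun t : ℝ => sqrtOneSub (t • C))
      (continuousOn_sqrtOneSub.comp (by fun_prop) hCt) (by simp [sqrtOneSub]) ?_ he he0 x
    · simpa using h
    · intro t ht
      refine ⟨1 - t, sub_pos.2 ht.2, fun x => ?_⟩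
      rw [← mul_apply_eq_comp, sqrtOneSub_mul_self (hCt t (Set.Ico_subset_Icc_self ht)),
        _root_.sub_apply, one_apply_eq_self, inner_sub_right, inner_self_eq_norm_sq_to_K, sub_re]
      have h1 : (inner ℂ x ((t • C) x)).re ≤ ‖x‖ * (t * ‖x‖) := by
        refine (re_inner_le_norm (𝕜 := ℂ) _ _).trans ?_
        gcongr
        rw [_root_.smul_apply, norm_smul, Real.norm_of_nonneg ht.1]
        have := ht.1
        gcongr
        exact (C.le_opNorm x).trans (mul_le_of_le_one_left (norm_nonneg _) hC)
      simp only [coe_algebraMap, ← ofReal_pow, ofReal_re]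
      nlinarith
  -- As `(1 - I)² = -2I`, the square of `k (1 - I)` times `2δI` is `4δk² = 1`. Taking `e = 1 ± I`
  -- puts the form of the root in `|arg| ≤ π/4`, which `1 - I` rotates into the fourth quadrant.
  set k : ℝ := (2 * √δ)⁻¹ with hk
  have hsq : 0 < √δ := Real.sqrt_pos.2 hδ
  have hk0 : 0 ≤ k := by positivity
  have hkδ : 4 * δ * k ^ 2 = 1 := by
    rw [hk, inv_pow, mul_pow, Real.sq_sqrt hδ.le]; field_simp; norm_num
  have hre := hquad (1 - I) (by simp [sq]) (by simp)
  have him := hquad (1 + I) (by simp [sq]) (by simp)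
  have hform : ∀ x, inner ℂ x (((k * (1 - I) : ℂ) • sqrtOneSub C) x) =
      k * ((1 - I) * inner ℂ x (sqrtOneSub C x)) := fun x => by
    rw [_root_.smul_apply, inner_smul_right, mul_assoc]
  refine ⟨(k * (1 - I) : ℂ) • sqrtOneSub C, ?_, fun x => ?_, fun x => ?_, fun T hT => ?_⟩
  · rw [smul_mul_smul_comm, sqrtOneSub_mul_self hC, hCdef, sub_sub_cancel, smul_smul]
    have : (k * (1 - I) * (k * (1 - I)) * ((2 * δ : ℝ) * I) : ℂ) = (4 * δ * k ^ 2 : ℝ) := by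
      push_cast
      linear_combination (2 * δ * k ^ 2 * (I - 2) : ℂ) * I_sq
    rw [this, hkδ, ofReal_one, one_smul]
  · rw [hform, re_ofReal_mul]
    exact mul_nonneg hk0 (hre x)
  · rw [hform, im_ofReal_mul]
    refine mul_nonpos_of_nonneg_of_nonpos hk0 ?_
    have := him x
    simp at this ⊢
    linarith
  · have : Commute T C := (Commute.one_right T).sub_right (hT.smul_right _)
    exact (this.sqrtOneSub_right hC).smul_right _

/-- Two commuting square roots of an injective operator agree if the forms of both take values in
the closed fourth quadrant. -/
theorem eq_of_mul_self_eq_of_fourthQuadrant {S T : H →L[ℂ] H} (hST : Commute S T)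
    (h : S * S = T * T) (hinj : Function.Injective S)
    (hSre : ∀ x, 0 ≤ (inner ℂ x (S x)).re) (hSim : ∀ x, (inner ℂ x (S x)).im ≤ 0)
    (hTre : ∀ x, 0 ≤ (inner ℂ x (T x)).re) (hTim : ∀ x, (inner ℂ x (T x)).im ≤ 0) : S = T := by
  -- Two elements of the fourth quadrant with sum zero both vanish.
  have h0 : ∀ x, (S + T) x = 0 → x = 0 := by
    intro x hx
    have h1 : inner ℂ x (S x) + inner ℂ x (T x) = 0 := by
      rw [← inner_add_right, ← _root_.add_apply, hx, inner_zero_right]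
    have h2 := congrArg re h1
    have h3 := congrArg im h1
    simp only [add_re, add_im, zero_re, zero_im] at h2 h3
    have h4 : inner ℂ x (S x) = 0 := Complex.ext
      (le_antisymm (by have := hTre x; rw [zero_re]; linarith) (hSre x))
      (le_antisymm (hSim x) (by have := hTim x; rw [zero_im]; linarith))
    exact (injective_iff_map_eq_zero S).1 hinj x (apply_eq_zero_of_inner_eq_zero hSre hSim h4)
  have h1 : (S + T) * (S - T) = 0 := by
    rw [add_mul, mul_sub, mul_sub, h, hST.eq]; abel
  ext x
  have h2 := h0 ((S - T) x) (by rw [← mul_apply_eq_comp, h1]; rfl)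
  rwa [_root_.sub_apply, sub_eq_zero] at h2
end

/-! ### Operators with bounded inverse -/

namespace LinearPMap
variable {H : Type*} [NormedAddCommGroup H] [InnerProductSpace ℂ H]

/-- `S` is a bounded two-sided inverse of `B`, defined on the whole space. -/
structure IsBoundedInverse (B : H →ₗ.[ℂ] H) (S : H →L[ℂ] H) : Prop where
  left_inv : ∀ x : B.domain, S (B x) = x
  right_inv : ∀ y, ∃ h : S y ∈ B.domain, B ⟨S y, h⟩ = y

namespace IsBoundedInverse
variable {A B : H →ₗ.[ℂ] H} {S : H →L[ℂ] H}

theorem injective (h : B.IsBoundedInverse S) : Function.Injective S := by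
  intro x y hxy
  obtain ⟨hx, hx'⟩ := h.right_inv x
  obtain ⟨hy, hy'⟩ := h.right_inv y
  rw [← hx', ← hy']
  congr 2

theorem eq (hA : A.IsBoundedInverse S) (hB : B.IsBoundedInverse S) : A = B := by
  refine LinearPMap.ext (Submodule.ext fun x => ⟨fun hx => ?_, fun hx => ?_⟩) fun x hx hx' => ?_
  · rw [← show S (A ⟨x, hx⟩) = x from hA.left_inv ⟨x, hx⟩]
    exact (hB.right_inv _).1
  · rw [← show S (B ⟨x, hx⟩) = x from hB.left_inv ⟨x, hx⟩]
    exact (hA.right_inv _).1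
  · exact hA.injective ((hA.left_inv ⟨x, hx⟩).trans (hB.left_inv ⟨x, hx'⟩).symm)

theorem isClosed (h : B.IsBoundedInverse S) : B.IsClosed := by
  have : (B.graph : Set (H × H)) = {p | S p.2 = p.1} := by
    ext ⟨x, y⟩
    simp only [SetLike.mem_coe, mem_graph_iff, Set.mem_ofPred_eq]
    constructor
    · rintro ⟨x, rfl, rfl⟩
      exact h.left_inv x
    · rintro rfl
      obtain ⟨h1, h2⟩ := h.right_inv y
      exact ⟨⟨_, h1⟩, rfl, h2⟩
  rw [IsClosed, this]
  exact isClosed_eq (by fun_prop) (by fun_prop)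

theorem square (h : B.IsBoundedInverse S) : B.square.IsBoundedInverse (S * S) := by
  refine ⟨fun x => ?_, fun y => ?_⟩
  · obtain ⟨x, hx, hBx⟩ := x
    change S (S (B ⟨B ⟨x, hx⟩, hBx⟩)) = x
    rw [h.left_inv ⟨B ⟨x, hx⟩, hBx⟩]
    exact h.left_inv ⟨x, hx⟩
  · obtain ⟨h1, h2⟩ := h.right_inv y
    obtain ⟨h3, h4⟩ := h.right_inv (S y)
    refine ⟨⟨h3, h4.symm ▸ h1⟩, ?_⟩
    exact (congrArg B (Subtype.ext h4)).trans h2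

theorem zero_mem_resolventSet (h : B.IsBoundedInverse S) : 0 ∈ B.resolventSet := by
  refine ⟨-S, fun x => ?_, fun y => ?_⟩
  · simpa using h.left_inv x
  · obtain ⟨h1, h2⟩ := h.right_inv y
    refine ⟨B.domain.neg_mem h1, ?_⟩
    have : B ⟨(-S) y, B.domain.neg_mem h1⟩ = -B ⟨S y, h1⟩ := B.map_neg ⟨S y, h1⟩
    rw [this, h2]
    simp

theorem of_zero_mem_resolventSet (h : 0 ∈ B.resolventSet) : ∃ S, B.IsBoundedInverse S := by
  obtain ⟨R, h1, h2⟩ := h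
  refine ⟨-R, fun x => by simpa using h1 x, fun y => ?_⟩
  obtain ⟨h3, h4⟩ := h2 y
  refine ⟨B.domain.neg_mem h3, ?_⟩
  have : B ⟨(-R) y, B.domain.neg_mem h3⟩ = -B ⟨R y, h3⟩ := B.map_neg ⟨R y, h3⟩
  rw [this]
  simpa using h4

/-- Inversion conjugates form values, exchanging the fourth and the first quadrant. -/
theorem inner_apply_eq (h : B.IsBoundedInverse S) (f : B.domain) :
    inner ℂ (f : H) (B f) = starRingEnd ℂ (inner ℂ (B f) (S (B f))) := by
  rw [h.left_inv, inner_conj_symm]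

/-- A closed operator whose square is boundedly invertible is itself boundedly invertible. -/
theorem of_square [CompleteSpace H] (hB : B.IsClosed) {K : H →L[ℂ] H}
    (h : B.square.IsBoundedInverse K) : ∃ S, B.IsBoundedInverse S ∧ S * S = K := by
  have hdom : ∀ y, K y ∈ B.domain := fun y => (h.right_inv y).1.1
  have hdom2 : ∀ y, B ⟨K y, hdom y⟩ ∈ B.domain := fun y => (h.right_inv y).1.2
  have hright : ∀ y, B ⟨B ⟨K y, hdom y⟩, hdom2 y⟩ = y := fun y => (h.right_inv y).2
  have hleft : ∀ (x : B.domain) (hx : B x ∈ B.domain), K (B ⟨B x, hx⟩) = x :=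
    fun x hx => h.left_inv ⟨x, x.2, hx⟩
  -- The inverse must be `B K`; it is defined everywhere and closed, hence bounded by the closed
  -- graph theorem.
  let L : H →ₗ[ℂ] H := B.toFun ∘ₗ (K : H →ₗ[ℂ] H).codRestrict B.domain hdom
  have hL : ∀ y, L y = B ⟨K y, hdom y⟩ := fun y => rfl
  have hclosed : _root_.IsClosed (L.graph : Set (H × H)) := by
    have : (L.graph : Set (H × H)) = (fun p : H × H => (K p.1, p.2)) ⁻¹' (B.graph : Set (H × H)) := by
      ext ⟨x, y⟩
      simp only [SetLike.mem_coe, LinearMap.mem_graph_iff, Set.mem_preimage, mem_graph_iff, hL]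
      constructor
      · intro hy
        exact ⟨⟨K x, hdom x⟩, rfl, hy.symm⟩
      · rintro ⟨z, hz, hzy⟩
        rw [← hzy]
        congr 1
        exact Subtype.ext hz
    rw [this]
    exact _root_.IsClosed.preimage (by fun_prop) hB
  have hker : ∀ x : B.domain, B x = 0 → x = 0 := by
    intro x hx
    have h1 : B x ∈ B.domain := by rw [hx]; exact B.domain.zero_mem
    have h2 : (⟨B x, h1⟩ : B.domain) = 0 := Subtype.ext hx
    have h3 := hleft x h1
    rw [h2, B.map_zero, _root_.map_zero] at h3
    exact Subtype.ext h3.symm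
  have hinj : ∀ x y : B.domain, B x = B y → x = y := fun x y hxy =>
    sub_eq_zero.1 (hker _ (by rw [B.map_sub, hxy, sub_self]))
  refine ⟨ContinuousLinearMap.ofIsClosedGraph hclosed, ⟨fun x => ?_, fun y => ?_⟩, ?_⟩
  · exact congrArg Subtype.val (hinj ⟨_, hdom2 (B x)⟩ x (hright (B x)))
  · exact ⟨hdom2 y, hright y⟩
  · ext y
    change B ⟨K (B ⟨K y, hdom y⟩), hdom _⟩ = K y
    have h1 := hright (B ⟨K y, hdom y⟩)
    have h2 := hinj ⟨_, hdom2 (B ⟨K y, hdom y⟩)⟩ ⟨K y, hdom y⟩ h1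
    exact congrArg Subtype.val h2

end IsBoundedInverse

theorem exists_isBoundedInverse {S : H →L[ℂ] H} (hS : Function.Injective S) :
    ∃ B : H →ₗ.[ℂ] H, B.IsBoundedInverse S := by
  let e := LinearEquiv.ofInjective (S : H →ₗ[ℂ] H) hS
  refine ⟨⟨LinearMap.range (S : H →ₗ[ℂ] H), e.symm⟩, fun x => ?_, fun y => ⟨⟨y, rfl⟩, ?_⟩⟩
  · exact congrArg Subtype.val (e.apply_symm_apply x)
  · exact e.symm_apply_apply y

end LinearPMap

/-! ### The square root of `A` -/

theorem proposition3p3 {H : Type*} [NormedAddCommGroup H] [InnerProductSpace ℂ H] [CompleteSpace H]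
    (A : H →ₗ.[ℂ] H) (hA : A.IsClosed) (δ : ℝ) (hδ : 0 < δ)
    (hAδ : A.spectrum ∪ closure A.numericalRange ⊆ {z : ℂ | δ ≤ z.im}) :
    ∃ B : H →ₗ.[ℂ] H,
      A.IsSquareRoot B ∧
      B.spectrum ⊆ firstQuadrant ∧
      B.numericalRange ⊆ firstQuadrant ∧
      B.spectrum ⊆ closure B.numericalRange ∧
      (∀ B' : H →ₗ.[ℂ] H, A.IsSquareRoot B' → B'.numericalRange ⊆ firstQuadrant → B' = B) := by
  have hreal : ∀ t : ℝ, (t : ℂ) ∈ A.resolventSet := by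
    intro t
    by_contra ht
    have : δ ≤ (t : ℂ).im := hAδ (Or.inl ht)
    rw [ofReal_im] at this
    linarith
  obtain ⟨K, hK⟩ := LinearPMap.IsBoundedInverse.of_zero_mem_resolventSet (by simpa using hreal 0)
  have hKim : ∀ y, δ * ‖K y‖ ^ 2 ≤ (inner ℂ (K y) y).im := by
    intro y
    obtain ⟨h1, h2⟩ := hK.right_inv y
    rcases (norm_nonneg (K y)).eq_or_lt with h0 | h0
    · rw [norm_eq_zero.1 h0.symm]; simp
    have hw : inner ℂ (K y) y / (‖K y‖ ^ 2 : ℝ) ∈ A.numericalRange := by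
      refine LinearPMap.mem_numericalRange_of_inner_eq (x := ⟨K y, h1⟩) (fun h' => ?_) ?_
      · rw [Submodule.mk_eq_zero] at h'; simp [h'] at h0
      · rw [h2]
        exact (div_mul_cancel₀ _ (ofReal_ne_zero.2 (pow_pos h0 2).ne')).symm
    have h3 : δ ≤ (inner ℂ (K y) y / (‖K y‖ ^ 2 : ℝ)).im := hAδ (Or.inr (subset_closure hw))
    rwa [div_ofReal_im, le_div_iff₀ (by positivity)] at h3
  obtain ⟨S, hSK, hSre, hSim, hcomm⟩ := exists_mul_self_eq_fourthQuadrant hδ hKim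
  have hSinj : Function.Injective S := by
    have h := hK.injective
    rw [← hSK] at h
    exact fun x y hxy => h (congrArg S hxy)
  obtain ⟨B, hB⟩ := LinearPMap.exists_isBoundedInverse hSinj
  have hBW : B.numericalRange ⊆ firstQuadrant := by
    rintro _ ⟨f, -, rfl⟩
    rw [hB.inner_apply_eq]
    exact ⟨by simpa only [conj_re] using hSre _, by simpa only [conj_im, neg_nonneg] using hSim _⟩
  have hBσ := LinearPMap.spectrum_subset_closure_numericalRange hBW hB.zero_mem_resolventSet
  have hclosed : IsClosed firstQuadrant :=
    (isClosed_le continuous_const continuous_re).inter (isClosed_le continuous_const continuous_im)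
  have hBQ : B.spectrum ⊆ firstQuadrant := hBσ.trans (closure_minimal hBW hclosed)
  have hsquare : B.square = A := (hSK ▸ hB.square).eq hK
  refine ⟨B, ⟨hA, fun t _ => hreal t, hB.isClosed, hsquare, fun z hz => (hBQ hz).1⟩, hBQ, hBW, hBσ,
    fun B' hB' hW' => ?_⟩
  obtain ⟨T, hT, hTK⟩ :=
    LinearPMap.IsBoundedInverse.of_square hB'.isClosed_root (hB'.square_eq.symm ▸ hK)
  have hTquad : ∀ x, 0 ≤ (inner ℂ x (T x)).re ∧ (inner ℂ x (T x)).im ≤ 0 := by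
    intro x
    obtain ⟨h1, h2⟩ := hT.right_inv x
    rcases (norm_nonneg (T x)).eq_or_lt with h0 | h0
    · rw [norm_eq_zero.1 h0.symm]; simp
    have hn : (0 : ℝ) < ‖T x‖ ^ 2 := by positivity
    have hw : inner ℂ (T x) x / (‖T x‖ ^ 2 : ℝ) ∈ B'.numericalRange := by
      refine LinearPMap.mem_numericalRange_of_inner_eq (x := ⟨T x, h1⟩) (fun h' => ?_) ?_
      · rw [Submodule.mk_eq_zero] at h'; simp [h'] at h0
      · rw [h2]
        exact (div_mul_cancel₀ _ (ofReal_ne_zero.2 hn.ne')).symm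
    obtain ⟨h3, h4⟩ := hW' hw
    rw [div_ofReal_re, le_div_iff₀ hn, zero_mul] at h3
    rw [div_ofReal_im, le_div_iff₀ hn, zero_mul] at h4
    rw [← inner_conj_symm, conj_re, conj_im]
    exact ⟨h3, neg_nonpos.2 h4⟩
  -- `T` commutes with `K = T * T`, hence with `S`.
  have hTS : T = S := (eq_of_mul_self_eq_of_fourthQuadrant
    (hcomm T (hTK ▸ (Commute.refl T).mul_right (Commute.refl T))).symm (hSK.trans hTK.symm) hSinj
    hSre hSim (fun x => (hTquad x).1) (fun x => (hTquad x).2)).symm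
  exact (hTS ▸ hT).eq hB
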